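/- Let $K$ be a field of characteristic zero (for example $K=\mathbb{R}$). An Appell sequence is a sequence $A=(A_n)_{n\ge 0}$ of polynomials in $K[x]$ with $A_0=1$ and $A_n'=nA_{n-1}$ for all $n\ge 1$. Its exponential generating function is $\sum_{n\ge 0}A_n(x)\frac{t^n}{n!}=e^{xt}f_A(t)$, where $f_A(t)=\sum_{n\ge 0}A_n(0)\frac{t^n}{n!}\in K[[t]]$. For a partition $\lambda=(\lambda_1\ge\dots\ge\lambda_r>0)$ define the Wronskian Appell polynomial $$A_\lambda=\frac{\mathrm{Wr}[A_{n_1},\dots,A_{n_r}]}{\prod_{1\le i<j\le r}(n_j-n_i)},\qquad (n_1,\dots,n_r)=(\lambda_r,\ \lambda_{r-1}+1,\ \dots,\ \lambda_1+r-1),$$ where $\mathrm{Wr}$ is the Wronskian determinant (so $A_\emptyset=1$). Let $\lambda'$ denote the conjugate partition of $\lambda$ and let $(1^n)$ be the partition with $n$ parts equal to $1$. **Theorem.** Let $A=(A_n)_{n\ge 0}$ be an Appell sequence. Then: (a) The sequence $A^*=(A^*_n)_{n\ge 0}$ defined by $A^*_n=A_{(1^n)}$ is also an Appell sequence. (b)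 The Wronskian Appell polynomials of $A$ and $A^*$ satisfy $A^*_\lambda=A_{\lambda'}$ for every partition $\lambda$. (c) $f_{A^*}(t)=1/f_A(-t)$ as formal power series; and if $\log f_A(t)=\sum_{k\ge 1}c_k\frac{t^k}{k!}$, then $\log f_{A^*}(t)=\sum_{k\ge 1}(-1)^{k-1}c_k\frac{t^k}{k!}$. -/

import Mathlib

namespace WronskianAppell

open Polynomial PowerSeries

variable {K : Type*} [Field K]

/-- An Appell sequence: `A₀ = 1` and `Aₙ' = n Aₙ₋₁` for all `n ≥ 1`. -/
structure IsAppell (A : ℕ → K[X]) : Prop where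
  zero : A 0 = 1
  derivative_succ : ∀ n : ℕ, derivative (A (n + 1)) = ((n + 1 : ℕ) : K[X]) * A n

/-- The Wronskian `Wr[f₁, …, f_r]`, the determinant of the matrix of iterated derivatives
`fᵢ^(j)`, `0 ≤ j < r`. -/
noncomputable def wronskian {r : ℕ} (f : Fin r → K[X]) : K[X] :=
  (Matrix.of fun i j : Fin r => derivative^[(j : ℕ)] (f i)).det

/-- The length `ℓ(μ)` of a partition: its number of non-zero parts. Partitions are Young diagrams,
where `μ.rowLen i` is the `(i + 1)`-st part of `μ`. -/
def length (μ : YoungDiagram) : ℕ := μ.colLen 0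

/-- The degree vector `(μ_r, μ_{r-1} + 1, …, μ_1 + r - 1)` of a partition `μ` of length `r`. -/
def degreeVector (μ : YoungDiagram) (i : Fin (length μ)) : ℕ :=
  μ.rowLen (i.rev : ℕ) + (i : ℕ)

/-- The Vandermonde determinant `Δ(n₁, …, n_r) = det [nᵢ ^ (j - 1)]` of the degree vector. -/
def delta (K : Type*) [Field K] (μ : YoungDiagram) : K :=
  (Matrix.vandermonde fun i => (degreeVector μ i : K)).det

theorem degreeVector_strictMono (μ : YoungDiagram) : StrictMono (degreeVector μ) := by
  intro i j h
  have h1 : μ.rowLen (i.rev : ℕ) ≤ μ.rowLen (j.rev : ℕ) :=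
    μ.rowLen_anti _ _ (Fin.rev_le_rev.mpr h.le)
  have h2 : (i : ℕ) < (j : ℕ) := h
  unfold degreeVector
  omega

/-- The division by `delta` below is never a division by zero. -/
theorem delta_ne_zero [CharZero K] (μ : YoungDiagram) : delta K μ ≠ 0 := by
  rw [delta, Matrix.det_vandermonde_ne_zero_iff]
  exact Nat.cast_injective.comp (degreeVector_strictMono μ).injective

/-- The Wronskian Appell polynomial `A_μ = Wr[A_{n₁}, …, A_{n_r}] / Δ(n₁, …, n_r)`, where
`(n₁, …, n_r)` is the degree vector of the partition `μ`. -/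
noncomputable def wronskianAppell (A : ℕ → K[X]) (μ : YoungDiagram) : K[X] :=
  Polynomial.C (delta K μ)⁻¹ * wronskian fun i => A (degreeVector μ i)

/-- The partition `(1ⁿ)`, with `n` parts equal to `1`. -/
def column (n : ℕ) : YoungDiagram :=
  YoungDiagram.ofRowLens (List.replicate n 1) (List.pairwise_replicate.mpr (Or.inr le_rfl) : List.Pairwise (· ≥ ·) _).sortedGE

/-- The dual sequence `A*ₙ = A_{(1ⁿ)}`. -/
noncomputable def dual (A : ℕ → K[X]) (n : ℕ) : K[X] :=
  wronskianAppell A (column n)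

/-- The formal power series `f_A(t) = ∑ₙ Aₙ(0) tⁿ / n!`. -/
noncomputable def genFun (A : ℕ → K[X]) : K⟦X⟧ :=
  PowerSeries.mk fun n => (A n).eval 0 / (n.factorial : K)

theorem constantCoeff_genFun {A : ℕ → K[X]} (hA : IsAppell A) :
    PowerSeries.constantCoeff (genFun A) = 1 := by
  simp [genFun, ← PowerSeries.coeff_zero_eq_constantCoeff_apply, hA.zero]

/-- The defining property of `f_A`: `∑ₙ Aₙ(x) tⁿ / n! = exp(x t) f_A(t)`. -/
theorem mk_eq_exp_mul_genFun [CharZero K] {A : ℕ → K[X]} (hA : IsAppell A) :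
    (PowerSeries.mk fun n => Polynomial.C (n.factorial : K)⁻¹ * A n) =
      PowerSeries.rescale (Polynomial.X : K[X]) (PowerSeries.exp K[X]) *
        PowerSeries.map Polynomial.C (genFun A) := by
  have key : ∀ n : ℕ, Polynomial.C (n.factorial : K)⁻¹ * A n =
      ∑ p ∈ Finset.HasAntidiagonal.antidiagonal n,
        Polynomial.C ((p.1.factorial : K)⁻¹ * ((A p.2).eval 0 / (p.2.factorial : K))) *
          Polynomial.X ^ p.1 := by
    intro n
    ext k
    have hk : ∀ k n : ℕ, (A (n + k)).coeff k * (k.factorial : K) * (n.factorial : K) =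
        ((n + k).factorial : K) * (A n).eval 0 := by
      intro k
      induction k with
      | zero => intro n; simp [Polynomial.coeff_zero_eq_eval_zero, mul_comm]
      | succ k ih =>
        intro n
        have h1 := congrArg (fun p => Polynomial.coeff p k) (hA.derivative_succ (n + k))
        simp only [Polynomial.coeff_derivative, Polynomial.coeff_natCast_mul] at h1
        have h2 := ih n
        rw [← add_assoc, Nat.factorial_succ, Nat.factorial_succ]
        push_cast at h1 ⊢
        linear_combination (k.factorial : K) * (n.factorial : K) * h1 + ((n : K) + k + 1) * h2
    have hlt : ∀ n k : ℕ, n < k → (A n).coeff k = 0 := by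
      intro n
      induction n with
      | zero =>
        intro k hk
        rw [hA.zero, Polynomial.coeff_one, if_neg (by omega)]
      | succ n ih =>
        intro k hk
        obtain ⟨k, rfl⟩ : ∃ j, k = j + 1 := ⟨k - 1, by omega⟩
        have h1 := congrArg (fun p => Polynomial.coeff p k) (hA.derivative_succ n)
        simp only [Polynomial.coeff_derivative, Polynomial.coeff_natCast_mul,
          ih k (by omega), mul_zero] at h1
        exact (mul_eq_zero.mp h1).resolve_right (by exact_mod_cast k.succ_ne_zero)
    simp only [Polynomial.finsetSum_coeff, Polynomial.coeff_C_mul, Polynomial.coeff_X_pow]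
    by_cases hkn : k ≤ n
    · obtain ⟨m, rfl⟩ : ∃ m, n = m + k := ⟨n - k, by omega⟩
      rw [Finset.sum_eq_single (k, m)]
      · have h0 : ∀ j : ℕ, (j.factorial : K) ≠ 0 := fun j =>
          Nat.cast_ne_zero.mpr j.factorial_ne_zero
        have := hk k m
        have a1 := h0 k
        have a2 := h0 m
        have a3 := h0 (m + k)
        simp only [if_true, mul_one]
        field_simp
        linear_combination this
      · rintro ⟨a, b⟩ hab hne
        rw [Finset.HasAntidiagonal.mem_antidiagonal] at hab
        rw [if_neg, mul_zero]
        rintro rfl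
        exact hne (by simp only [Prod.mk.injEq, true_and]; simp only at hab; omega)
      · intro h
        exact absurd (Finset.HasAntidiagonal.mem_antidiagonal.mpr (add_comm k m)) h
    · rw [hlt n k (by omega), mul_zero, Finset.sum_eq_zero]
      rintro ⟨a, b⟩ hab
      rw [Finset.HasAntidiagonal.mem_antidiagonal] at hab
      rw [if_neg (by simp only at hab ⊢; omega), mul_zero]
  ext1 n
  rw [PowerSeries.coeff_mk, key, PowerSeries.coeff_mul]
  refine Finset.sum_congr rfl fun p _ => ?_
  have he : algebraMap ℚ K[X] (1 / (p.1.factorial : ℚ)) =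
      Polynomial.C (p.1.factorial : K)⁻¹ := by
    rw [IsScalarTower.algebraMap_apply ℚ K K[X]]
    simp
  rw [PowerSeries.coeff_rescale, PowerSeries.coeff_exp, PowerSeries.coeff_map, he, genFun,
    PowerSeries.coeff_mk, map_mul]
  ring

/-- The formal power series `∑_{k ≥ 1} c_k tᵏ / k!`. -/
noncomputable def cumulantSeries (c : ℕ → K) : K⟦X⟧ :=
  PowerSeries.mk fun k => if k = 0 then 0 else c k / (k.factorial : K)

/-- `log f_A(t)` always has the form `∑_{k ≥ 1} c_k tᵏ / k!`. -/
theorem exists_logOf_genFun_eq [CharZero K] {A : ℕ → K[X]} (hA : IsAppell A) :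
    ∃ c : ℕ → K, PowerSeries.logOf (genFun A) = cumulantSeries c := by
  refine ⟨fun k => (k.factorial : K) * PowerSeries.coeff k (PowerSeries.logOf (genFun A)), ?_⟩
  ext k
  rw [cumulantSeries, PowerSeries.coeff_mk]
  split_ifs with h
  · rw [h, PowerSeries.coeff_zero_eq_constantCoeff_apply,
      PowerSeries.constantCoeff_logOf (constantCoeff_genFun hA)]
  · rw [mul_div_cancel_left₀ _ (Nat.cast_ne_zero.mpr k.factorial_ne_zero)]

end WronskianAppell

/-! Put `h m = A m / m!`. Differentiation sends `h m` to `h (m - 1)`, so the Wronskian is `∏ nᵢ!`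
times the Jacobi–Trudi determinant `det [h (nᵢ - j)]`. Expanding in falling factorials, the
Vandermonde determinant is the same product times the determinant for `h m = 1 / m!`. Hence `A_μ` is
a quotient of two Jacobi–Trudi determinants.

If `H(t) E(-t) = 1`, the dual Jacobi–Trudi identity, obtained from Jacobi's complementary minors,
exchanges `h` with `e` and `μ` with `μ'` up to a unit depending only on `μ`. It applies to the
numerator when `f_A(t) f_B(-t) = 1`, and to the denominator because `exp(t) exp(-t) = 1`. The unit
cancels, so `A_μ = B_{μ'}`. Taking for `B` the Appell sequence with `f_B(t) = 1 / f_A(-t)` and `μ =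
(1ⁿ)` gives `A* = B`, from which all the claims follow. -/

namespace WronskianAppell

open Polynomial PowerSeries

/-! ### The dual Jacobi–Trudi identity -/

section JacobiTrudi

variable {R : Type*} [CommRing R]

/-- The entry `h (n - k)` of a lower triangular Toeplitz matrix, zero above the diagonal. -/
def toeplitz (h : ℕ → R) (n k : ℕ) : R :=
  if k ≤ n then h (n - k) else 0

/-- The sum is the coefficient of `t^(n - m)` in the product of the two series. Cutting it off at `N
> n` loses nothing, since only `m ≤ k ≤ n` contributes. -/
theorem sum_toeplitz_mul (h e : ℕ → R) (he : PowerSeries.mk h * PowerSeries.mk e = 1)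
    {N n : ℕ} (m : ℕ) (hn : n < N) :
    ∑ k ∈ Finset.range N, toeplitz h n k * toeplitz e k m = if n = m then 1 else 0 := by
  by_cases hmn : m ≤ n
  · have hc := congrArg (PowerSeries.coeff (n - m)) he
    rw [PowerSeries.coeff_mul, PowerSeries.coeff_one] at hc
    rw [show (if n = m then (1 : R) else 0) = if n - m = 0 then 1 else 0 from
      if_congr (by omega) rfl rfl, ← hc]
    symm
    refine Finset.sum_of_injOn (fun p => m + p.2) ?_ ?_ ?_ ?_
    · rintro ⟨a, b⟩ h1 ⟨c, d⟩ h2 h3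
      simp only [Finset.mem_coe, Finset.HasAntidiagonal.mem_antidiagonal] at h1 h2 h3
      simp only [Prod.mk.injEq]
      omega
    · rintro ⟨a, b⟩ h1
      simp only [Finset.mem_coe, Finset.HasAntidiagonal.mem_antidiagonal, Finset.mem_range] at h1 ⊢
      omega
    · intro k _ hk2
      by_cases h1 : k ≤ n
      · by_cases h2 : m ≤ k
        · refine absurd ⟨(n - k, k - m), ?_, ?_⟩ hk2
          · simp only [Finset.mem_coe, Finset.HasAntidiagonal.mem_antidiagonal]
            omega
          · simp only
            omega
        · simp [toeplitz, h2]
      · simp [toeplitz, h1]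
    · rintro ⟨a, b⟩ h1
      rw [Finset.HasAntidiagonal.mem_antidiagonal] at h1
      simp only at h1
      rw [PowerSeries.coeff_mk, PowerSeries.coeff_mk, toeplitz, toeplitz, if_pos (by omega),
        if_pos (by omega)]
      congr 2 <;> omega
  · rw [if_neg (by omega)]
    refine Finset.sum_eq_zero fun k _ => ?_
    by_cases h1 : k ≤ n
    · simp [toeplitz, show ¬ m ≤ k by omega]
    · simp [toeplitz, h1]

/-- Jacobi's identity for complementary minors of a pair of inverse matrices. -/
theorem det_mul_det_toBlocks₂₂ {m n : Type*} [Fintype m] [Fintype n] [DecidableEq m]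
    [DecidableEq n] (P Q : Matrix (m ⊕ n) (m ⊕ n) R) (h : P * Q = 1) :
    P.det * Q.toBlocks₂₂.det = P.toBlocks₁₁.det := by
  have h12 : P.toBlocks₁₁ * Q.toBlocks₁₂ + P.toBlocks₁₂ * Q.toBlocks₂₂ = 0 := by
    rw [← Matrix.fromBlocks_toBlocks P, ← Matrix.fromBlocks_toBlocks Q,
      Matrix.fromBlocks_multiply, ← Matrix.fromBlocks_one] at h
    exact (Matrix.fromBlocks_inj.mp h).2.1
  have h22 : P.toBlocks₂₁ * Q.toBlocks₁₂ + P.toBlocks₂₂ * Q.toBlocks₂₂ = 1 := by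
    rw [← Matrix.fromBlocks_toBlocks P, ← Matrix.fromBlocks_toBlocks Q,
      Matrix.fromBlocks_multiply, ← Matrix.fromBlocks_one] at h
    exact (Matrix.fromBlocks_inj.mp h).2.2.2
  -- Replacing the first block column of `Q` by that of the identity makes both sides block
  -- triangular up to the factor `P`, so no block has to be inverted.
  have hmul : P * Matrix.fromBlocks 1 Q.toBlocks₁₂ 0 Q.toBlocks₂₂ =
      Matrix.fromBlocks P.toBlocks₁₁ 0 P.toBlocks₂₁ 1 := by
    conv_lhs => rw [← Matrix.fromBlocks_toBlocks P]
    rw [Matrix.fromBlocks_multiply, h12, h22]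
    simp
  have := congrArg Matrix.det hmul
  rwa [Matrix.det_mul, Matrix.det_fromBlocks_zero₂₁, Matrix.det_fromBlocks_zero₁₂,
    Matrix.det_one, Matrix.det_one, one_mul, mul_one] at this

/-- The Jacobi–Trudi determinant `det [h_{μᵢ - i + j}]`, indexed through the degree vector. -/
def jacobiTrudi (h : ℕ → R) (μ : YoungDiagram) : R :=
  (Matrix.of fun i j : Fin (length μ) => toeplitz h (degreeVector μ i) j).det

theorem length_transpose (μ : YoungDiagram) : length μ.transpose = μ.rowLen 0 :=
  μ.colLen_transpose 0

theorem degreeVector_lt (μ : YoungDiagram) (i : Fin (length μ)) :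
    degreeVector μ i < length μ + length μ.transpose := by
  have h1 := μ.rowLen_anti 0 (i.rev : ℕ) (Nat.zero_le _)
  have h2 := i.isLt
  rw [length_transpose]
  unfold degreeVector
  omega

/-- Equality would force `(μ_a - b) + (μ'_b - a) = 1` with `a = i.rev`, `b = j.rev`. Both summands
are positive if the cell `(a, b)` lies in `μ`, and neither is positive otherwise. -/
theorem degreeVector_add_degreeVector_transpose_ne (μ : YoungDiagram) (i : Fin (length μ))
    (j : Fin (length μ.transpose)) :
    degreeVector μ i + degreeVector μ.transpose j + 1 ≠ length μ + length μ.transpose := by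
  have hi := Fin.val_rev i
  have hj := Fin.val_rev j
  have h1 : (j.rev : ℕ) < μ.rowLen (i.rev : ℕ) ↔ (i.rev : ℕ) < μ.colLen (j.rev : ℕ) := by
    rw [← YoungDiagram.mem_iff_lt_rowLen, YoungDiagram.mem_iff_lt_colLen]
  have h2 := i.isLt
  have h3 := j.isLt
  unfold degreeVector
  rw [YoungDiagram.rowLen_transpose]
  omega

/-- The degree vector of `μ` followed by the reflection of the degree vector of the conjugate
partition. -/
def complementaryIndex (μ : YoungDiagram) :
    Fin (length μ) ⊕ Fin (length μ.transpose) → Fin (length μ + length μ.transpose)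
  | Sum.inl i => ⟨degreeVector μ i, degreeVector_lt μ i⟩
  | Sum.inr j => ⟨length μ + length μ.transpose - 1 - degreeVector μ.transpose j, by
      have := j.isLt
      omega⟩

theorem degreeVector_transpose_lt (μ : YoungDiagram) (j : Fin (length μ.transpose)) :
    degreeVector μ.transpose j < length μ + length μ.transpose := by
  have := degreeVector_lt μ.transpose j
  rwa [YoungDiagram.transpose_transpose, add_comm] at this

theorem complementaryIndex_bijective (μ : YoungDiagram) :
    Function.Bijective (complementaryIndex μ) := by
  rw [Fintype.bijective_iff_injective_and_card]
  refine ⟨?_, by simp⟩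
  rintro (i | i) (j | j) h <;> simp only [complementaryIndex, Fin.mk.injEq] at h
  · rw [(degreeVector_strictMono μ).injective h]
  · have h1 := degreeVector_add_degreeVector_transpose_ne μ i j
    have h2 := degreeVector_transpose_lt μ j
    omega
  · have h1 := degreeVector_add_degreeVector_transpose_ne μ j i
    have h2 := degreeVector_transpose_lt μ i
    omega
  · have h1 := degreeVector_transpose_lt μ i
    have h2 := degreeVector_transpose_lt μ j
    rw [(degreeVector_strictMono μ.transpose).injective
      (by omega : degreeVector μ.transpose i = degreeVector μ.transpose j)]

/-- The initial segment `0, …, r - 1` followed by the remaining indices in decreasing order. -/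
def splitIndex (r s : ℕ) : Fin r ⊕ Fin s → Fin (r + s)
  | Sum.inl i => ⟨i, by omega⟩
  | Sum.inr j => ⟨r + s - 1 - j, by omega⟩

theorem splitIndex_bijective (r s : ℕ) : Function.Bijective (splitIndex r s) := by
  rw [Fintype.bijective_iff_injective_and_card]
  refine ⟨?_, by simp⟩
  rintro (i | i) (j | j) h <;> simp only [splitIndex, Fin.mk.injEq] at h
  · rw [Fin.ext h]
  · omega
  · omega
  · rw [Fin.ext (by omega : (i : ℕ) = j)]

/-- The sign splits into a row factor and a column factor, so it can be pulled out of a determinant.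
-/
theorem toeplitz_alternating (e : ℕ → R) (n k : ℕ) :
    toeplitz (fun m => (-1) ^ m * e m) n k = (-1) ^ n * ((-1) ^ k * toeplitz e n k) := by
  unfold toeplitz
  split_ifs with h
  · obtain ⟨m, rfl⟩ := Nat.exists_eq_add_of_le h
    have hk : (-1 : R) ^ k * (-1) ^ k = 1 := by rw [← mul_pow]; simp
    rw [Nat.add_sub_cancel_left, pow_add]
    linear_combination -(-1) ^ m * e m * hk
  · simp

/-- The dual Jacobi–Trudi identity, up to a sign that depends only on the partition. -/
theorem exists_jacobiTrudi_eq_mul_jacobiTrudi_transpose (R : Type*) [CommRing R]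
    (μ : YoungDiagram) :
    ∃ ε : R, IsUnit ε ∧ ∀ h e : ℕ → R, h 0 = 1 →
      PowerSeries.mk h * PowerSeries.mk (fun n => (-1) ^ n * e n) = 1 →
      jacobiTrudi h μ = ε * jacobiTrudi e μ.transpose := by
  let σ := Equiv.ofBijective _ (complementaryIndex_bijective μ)
  let τ := Equiv.ofBijective _ (splitIndex_bijective (length μ) (length μ.transpose))
  have hneg : ∀ n : ℕ, IsUnit ((-1 : R) ^ n) := fun n => isUnit_one.neg.pow n
  -- The permutation sign comes from reordering the rows of `H`, the two products from the
  -- alternating signs in `E`. Only invertibility and independence of `h` and `e` matter later.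
  refine ⟨((Equiv.Perm.sign (τ.symm.trans σ) : ℤ) : R) *
    ((∏ j, (-1) ^ degreeVector μ.transpose j) *
      ∏ i : Fin (length μ.transpose), (-1) ^ (i : ℕ)), ?_, ?_⟩
  · refine IsUnit.mul ((Units.isUnit _).map (Int.castRingHom R)) (IsUnit.mul ?_ ?_)
    · rw [Finset.prod_pow_eq_pow_sum]
      exact hneg _
    · rw [Finset.prod_pow_eq_pow_sum]
      exact hneg _
  · intro h e h0 he
    let N := length μ + length μ.transpose
    let H : Matrix (Fin N) (Fin N) R := Matrix.of fun n k => toeplitz h n k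
    let E : Matrix (Fin N) (Fin N) R :=
      Matrix.of fun n k => toeplitz (fun n => (-1) ^ n * e n) n k
    have hHE : H * E = 1 := by
      ext n m
      rw [Matrix.mul_apply, Matrix.one_apply]
      have := sum_toeplitz_mul h _ he (m : ℕ) n.isLt
      rw [← Fin.sum_univ_eq_sum_range
        (fun k => toeplitz h n k * toeplitz (fun n => (-1) ^ n * e n) k m)] at this
      simp only [Fin.ext_iff]
      exact this
    have hdetH : H.det = 1 := by
      rw [Matrix.det_of_isLowerTriangular]
      · refine Finset.prod_eq_one fun i _ => ?_
        simp [H, toeplitz, h0]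
      · intro i j hij
        have hij' : (i : ℕ) < j := hij
        simp only [H, Matrix.of_apply, toeplitz]
        rw [if_neg (by omega)]
    have hP : (H.submatrix σ τ).det = ((Equiv.Perm.sign (τ.symm.trans σ) : ℤ) : R) := by
      have h1 : H.submatrix σ τ = (H.submatrix (τ.symm.trans σ) id).submatrix τ τ := by
        ext i j
        simp
      rw [h1, Matrix.det_submatrix_equiv_self, Matrix.det_permute, hdetH, mul_one]
    have hPQ : H.submatrix σ τ * E.submatrix τ σ = 1 := by
      rw [Matrix.submatrix_mul_equiv, hHE, Matrix.submatrix_one_equiv]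
    have key := det_mul_det_toBlocks₂₂ _ _ hPQ
    have hA : (H.submatrix σ τ).toBlocks₁₁.det = jacobiTrudi h μ := rfl
    have hD : (E.submatrix τ σ).toBlocks₂₂.det =
        (∏ j, (-1) ^ degreeVector μ.transpose j) *
          ((∏ i : Fin (length μ.transpose), (-1) ^ (i : ℕ)) * jacobiTrudi e μ.transpose) := by
      rw [jacobiTrudi, ← Matrix.det_mul_row, ← Matrix.det_mul_column, ← Matrix.det_transpose]
      congr 1
      ext i j
      have hi := degreeVector_transpose_lt μ i
      simp only [Matrix.transpose_apply, Matrix.of_apply]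
      rw [← toeplitz_alternating]
      -- The reflection `n ↦ N - 1 - n` negates index differences and the transpose swaps them back,
      -- so the Toeplitz entry is that of the conjugate partition.
      have hE : (E.submatrix τ σ).toBlocks₂₂ j i =
          toeplitz (fun n => (-1) ^ n * e n) (length μ + length μ.transpose - 1 - (j : ℕ))
            (length μ + length μ.transpose - 1 - degreeVector μ.transpose i) := rfl
      rw [hE]
      unfold toeplitz
      have hj := j.isLt
      by_cases hij : (j : ℕ) ≤ degreeVector μ.transpose i
      · have hsub : length μ + length μ.transpose - 1 - (j : ℕ) -
            (length μ + length μ.transpose - 1 - degreeVector μ.transpose i) =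
            degreeVector μ.transpose i - j := by omega
        rw [if_pos (by omega), if_pos hij, hsub]
      · rw [if_neg (by omega), if_neg hij]
    rw [← hA, ← key, hP, hD]
    ring

end JacobiTrudi

/-! ### The partitions `(1ⁿ)` and `(n)` -/

section Column

variable {K : Type*} [Field K]

theorem mem_column {n i j : ℕ} : (i, j) ∈ column n ↔ i < n ∧ j = 0 := by
  simp [column, YoungDiagram.mem_ofRowLens]

theorem length_transpose_column (n : ℕ) : length (column n).transpose = min n 1 := by
  have h : ∀ j, j < (column n).rowLen 0 ↔ 0 < n ∧ j = 0 := fun j => by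
    rw [← YoungDiagram.mem_iff_lt_rowLen, mem_column]
  rw [length_transpose]
  have h0 := h 0
  have h1 := h 1
  omega

theorem rowLen_transpose_column (n : ℕ) : (column n).transpose.rowLen 0 = n := by
  rw [YoungDiagram.rowLen_transpose]
  refine eq_of_forall_lt_iff fun i => ?_
  rw [← YoungDiagram.mem_iff_lt_colLen, mem_column]
  simp

/-- The conjugate of `(1ⁿ)` is the single row `(n)`, so both determinants are `1 × 1`. For `n = 0`
they are empty, which matches `B 0 = 1`. -/
theorem wronskianAppell_transpose_column {B : ℕ → K[X]} (hB : IsAppell B) (n : ℕ) :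
    wronskianAppell B (column n).transpose = B n := by
  have hl := length_transpose_column n
  cases n with
  | zero =>
    have : IsEmpty (Fin (length (column 0).transpose)) := by
      rw [hl]
      exact Fin.isEmpty
    rw [wronskianAppell, delta, wronskian, Matrix.det_isEmpty, Matrix.det_isEmpty, hB.zero]
    simp
  | succ n =>
    have : Unique (Fin (length (column (n + 1)).transpose)) := by
      rw [hl, show min (n + 1) 1 = 1 by omega]
      infer_instance
    have hd : (default : Fin (length (column (n + 1)).transpose)).val = 0 := by
      omega
    have hr : (default : Fin (length (column (n + 1)).transpose)).rev.val = 0 := by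
      omega
    have hv : degreeVector (column (n + 1)).transpose default = n + 1 := by
      rw [degreeVector, hr, hd, rowLen_transpose_column, add_zero]
    rw [wronskianAppell, delta, wronskian, Matrix.det_unique, Matrix.det_unique,
      Matrix.vandermonde_apply, Matrix.of_apply, hd, hv]
    simp

end Column

/-! ### Wronskian Appell polynomials as quotients of Jacobi–Trudi determinants -/

section Appell

variable {K : Type*} [Field K] [CharZero K]

theorem IsAppell.iterate_derivative {A : ℕ → K[X]} (hA : IsAppell A) (n k : ℕ) :
    derivative^[k] (A n) = Polynomial.C (n.factorial : K) *
      toeplitz (fun m => Polynomial.C (m.factorial : K)⁻¹ * A m) n k := by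
  have hf : ∀ m : ℕ, (m.factorial : K) ≠ 0 := fun m =>
    Nat.cast_ne_zero.mpr m.factorial_ne_zero
  induction k generalizing n with
  | zero =>
    rw [toeplitz, if_pos n.zero_le, Nat.sub_zero, ← mul_assoc, ← Polynomial.C_mul,
      mul_inv_cancel₀ (hf n), Polynomial.C_1, one_mul, Function.iterate_zero, id]
  | succ k ih =>
    rw [Function.iterate_succ_apply]
    cases n with
    | zero =>
      rw [hA.zero, Polynomial.derivative_one, Polynomial.iterate_derivative_zero, toeplitz,
        if_neg (by omega), mul_zero]
    | succ n =>
      rw [hA.derivative_succ, ← Polynomial.C_eq_natCast, Polynomial.iterate_derivative_C_mul, ih,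
        ← mul_assoc, ← Polynomial.C_mul, Nat.factorial_succ, Nat.cast_mul]
      simp only [toeplitz, Nat.add_le_add_iff_right, Nat.add_sub_add_right]

theorem wronskian_eq_mul_jacobiTrudi {A : ℕ → K[X]} (hA : IsAppell A) (μ : YoungDiagram) :
    wronskian (fun i => A (degreeVector μ i)) =
      (∏ i, Polynomial.C ((degreeVector μ i).factorial : K)) *
        jacobiTrudi (fun m => Polynomial.C (m.factorial : K)⁻¹ * A m) μ := by
  rw [wronskian, jacobiTrudi, ← Matrix.det_mul_column]
  congr 1
  ext1 i j
  exact hA.iterate_derivative _ _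

/-- Monic falling factorials may replace the powers in a Vandermonde determinant, and the `j`-th one
at `n` is `n! / (n - j)!`, or zero when `j > n`. -/
theorem delta_eq_mul_jacobiTrudi (μ : YoungDiagram) :
    Polynomial.C (delta K μ) = (∏ i, Polynomial.C ((degreeVector μ i).factorial : K)) *
      jacobiTrudi (fun m => Polynomial.C (m.factorial : K)⁻¹) μ := by
  rw [jacobiTrudi, ← Matrix.det_mul_column, delta,
    Matrix.det_eval_matrixOfPolynomials_eq_det_vandermonde _
      (fun i : Fin (length μ) => descPochhammer K i) (fun i => descPochhammer_natDegree K i)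
      (fun i => monic_descPochhammer K i), RingHom.map_det]
  congr 1
  ext1 i j
  simp only [RingHom.mapMatrix_apply, Matrix.map_apply, Matrix.of_apply,
    descPochhammer_eval_eq_descFactorial, toeplitz]
  split_ifs with h
  · rw [← Polynomial.C_mul, ← Nat.factorial_mul_descFactorial h, Nat.cast_mul,
      mul_right_comm, mul_inv_cancel₀ (Nat.cast_ne_zero.mpr (Nat.factorial_ne_zero _)), one_mul]
  · rw [Nat.descFactorial_of_lt (by omega)]
    simp

theorem jacobiTrudi_inv_factorial_mul_wronskianAppell {A : ℕ → K[X]} (hA : IsAppell A)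
    (μ : YoungDiagram) :
    jacobiTrudi (fun m => Polynomial.C (m.factorial : K)⁻¹) μ * wronskianAppell A μ =
      jacobiTrudi (fun m => Polynomial.C (m.factorial : K)⁻¹ * A m) μ := by
  have hprod : (∏ i, Polynomial.C ((degreeVector μ i).factorial : K)) ≠ 0 :=
    Finset.prod_ne_zero_iff.mpr fun i _ =>
      Polynomial.C_ne_zero.mpr (Nat.cast_ne_zero.mpr (Nat.factorial_ne_zero _))
  apply mul_left_cancel₀ hprod
  rw [← wronskian_eq_mul_jacobiTrudi hA, ← mul_assoc, ← delta_eq_mul_jacobiTrudi,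
    wronskianAppell, ← mul_assoc, ← Polynomial.C_mul, mul_inv_cancel₀ (delta_ne_zero μ),
    Polynomial.C_1, one_mul]

theorem jacobiTrudi_inv_factorial_ne_zero (μ : YoungDiagram) :
    jacobiTrudi (fun m => Polynomial.C (m.factorial : K)⁻¹) μ ≠ 0 := by
  intro h
  have := delta_eq_mul_jacobiTrudi (K := K) μ
  rw [h, mul_zero, Polynomial.C_eq_zero] at this
  exact delta_ne_zero μ this

theorem mk_C_inv_factorial :
    (PowerSeries.mk fun n => Polynomial.C (n.factorial : K)⁻¹) = PowerSeries.exp K[X] := by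
  ext1 n
  rw [PowerSeries.coeff_mk, PowerSeries.coeff_exp, IsScalarTower.algebraMap_apply ℚ K K[X]]
  simp

/-- Conjugating the partition exchanges Appell sequences whose exponential generating functions
satisfy `f_A(t) f_B(-t) = 1`. -/
theorem wronskianAppell_eq_wronskianAppell_transpose {A B : ℕ → K[X]} (hA : IsAppell A)
    (hB : IsAppell B) (h : genFun A * PowerSeries.rescale (-1 : K) (genFun B) = 1)
    (μ : YoungDiagram) : wronskianAppell A μ = wronskianAppell B μ.transpose := by
  obtain ⟨ε, hε, key⟩ := exists_jacobiTrudi_eq_mul_jacobiTrudi_transpose K[X] μ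
  have hneg : ∀ e : ℕ → K[X], PowerSeries.mk (fun n => (-1) ^ n * e n) =
      PowerSeries.rescale (-1 : K[X]) (PowerSeries.mk e) := fun e => by
    ext1 n
    rw [PowerSeries.coeff_rescale, PowerSeries.coeff_mk, PowerSeries.coeff_mk]
  have hexp : PowerSeries.exp K[X] * PowerSeries.rescale (-1 : K[X]) (PowerSeries.exp K[X]) = 1 :=
    PowerSeries.exp_mul_exp_neg_eq_one
  -- This instance and `h2` share the same `ε`, which therefore cancels in the quotient.
  have h1 := key (fun m => Polynomial.C (m.factorial : K)⁻¹)
    (fun m => Polynomial.C (m.factorial : K)⁻¹) (by simp)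
    (by rw [hneg, mk_C_inv_factorial, hexp])
  have hmap : PowerSeries.rescale (-1 : K[X]) (PowerSeries.map Polynomial.C (genFun B)) =
      PowerSeries.map Polynomial.C (PowerSeries.rescale (-1 : K) (genFun B)) := by
    ext1 n
    simp [PowerSeries.coeff_rescale]
  have hcomm : PowerSeries.rescale (-1 : K[X])
        (PowerSeries.rescale Polynomial.X (PowerSeries.exp K[X])) =
      PowerSeries.rescale Polynomial.X
        (PowerSeries.rescale (-1 : K[X]) (PowerSeries.exp K[X])) := by
    rw [PowerSeries.rescale_rescale, PowerSeries.rescale_rescale, mul_comm]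
  have h2 := key (fun m => Polynomial.C (m.factorial : K)⁻¹ * A m)
    (fun m => Polynomial.C (m.factorial : K)⁻¹ * B m) (by simp [hA.zero]) (by
      rw [hneg, mk_eq_exp_mul_genFun hA, mk_eq_exp_mul_genFun hB, map_mul, hmap, hcomm,
        mul_mul_mul_comm, ← map_mul, hexp, ← map_mul, h, map_one, map_one, one_mul])
  rw [← jacobiTrudi_inv_factorial_mul_wronskianAppell hA,
    ← jacobiTrudi_inv_factorial_mul_wronskianAppell hB, h1, mul_assoc] at h2
  exact mul_left_cancel₀ (jacobiTrudi_inv_factorial_ne_zero _) (hε.mul_left_cancel h2)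

/-- The sequence of polynomials with exponential generating function `exp(x t) g(t)`. -/
noncomputable def ofGenFun (g : K⟦X⟧) (n : ℕ) : K[X] :=
  Polynomial.C (n.factorial : K) * ∑ p ∈ Finset.HasAntidiagonal.antidiagonal n,
    Polynomial.C ((p.1.factorial : K)⁻¹ * PowerSeries.coeff p.2 g) * Polynomial.X ^ p.1

theorem isAppell_ofGenFun {g : K⟦X⟧} (hg : PowerSeries.constantCoeff g = 1) :
    IsAppell (ofGenFun g) := by
  refine ⟨by simp [ofGenFun, hg], fun n => ?_⟩
  rw [ofGenFun, ofGenFun, Polynomial.derivative_C_mul, Finset.Nat.antidiagonal_succ,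
    Finset.sum_cons, Finset.sum_map, Polynomial.derivative_add, Polynomial.derivative_sum,
    ← mul_assoc, ← Polynomial.C_eq_natCast, ← Polynomial.C_mul, Nat.factorial_succ, Nat.cast_mul]
  -- The term split off from the antidiagonal is constant in `x` and disappears; the others match
  -- after a shift of the exponent.
  simp only [pow_zero, mul_one, Polynomial.derivative_C, zero_add]
  congr 1
  refine Finset.sum_congr rfl fun p _ => ?_
  have h1 : ((p.1 : K) + 1) ≠ 0 := Nat.cast_add_one_ne_zero p.1
  simp only [Function.Embedding.prodMap, Function.Embedding.coeFn_mk, Prod.map,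
    Function.Embedding.refl_apply, Nat.succ_eq_add_one]
  rw [Polynomial.derivative_C_mul_X_pow, Nat.add_sub_cancel, Nat.factorial_succ]
  congr 2
  have h2 : (p.1.factorial : K) ≠ 0 := Nat.cast_ne_zero.mpr p.1.factorial_ne_zero
  push_cast
  field_simp

theorem genFun_ofGenFun (g : K⟦X⟧) : genFun (ofGenFun g) = g := by
  ext1 n
  have hn : (n.factorial : K) ≠ 0 := Nat.cast_ne_zero.mpr n.factorial_ne_zero
  rw [genFun, PowerSeries.coeff_mk, ofGenFun, Polynomial.eval_mul, Polynomial.eval_C,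
    mul_div_cancel_left₀ _ hn, Polynomial.eval_finsetSum, Finset.sum_eq_single (0, n)]
  · simp
  · rintro ⟨a, b⟩ hab hne
    have ha : a ≠ 0 := by
      rintro rfl
      rw [Finset.HasAntidiagonal.mem_antidiagonal] at hab
      exact hne (by simpa using hab)
    simp [ha]
  · simp

end Appell

/-! ### Logarithms of power series -/

section Log

variable {K : Type*} [Field K]

theorem derivative_rescale (a : K) (f : K⟦X⟧) :
    PowerSeries.derivative K (PowerSeries.rescale a f) =
      PowerSeries.C a * PowerSeries.rescale a (PowerSeries.derivative K f) := by
  ext n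
  simp only [PowerSeries.coeff_derivative, PowerSeries.coeff_rescale, PowerSeries.coeff_C_mul]
  ring

theorem constantCoeff_rescale (a : K) (f : K⟦X⟧) :
    PowerSeries.constantCoeff (PowerSeries.rescale a f) = PowerSeries.constantCoeff f := by
  rw [← PowerSeries.coeff_zero_eq_constantCoeff_apply, PowerSeries.coeff_rescale]
  simp

variable [CharZero K]

/-- Substitute `f - 1` into `log'(1 + X) · (1 + X) = 1` and use the chain rule. In characteristic
zero a series is determined by its derivative and constant term, so this yields the rules for
`logOf` below. -/
theorem derivative_logOf_mul {f : K⟦X⟧} (hf : PowerSeries.constantCoeff f = 1) :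
    PowerSeries.derivative K (PowerSeries.logOf f) * f = PowerSeries.derivative K f := by
  have hs : PowerSeries.HasSubst (f - 1) :=
    PowerSeries.HasSubst.of_constantCoeff_zero' (by simp [hf])
  have hlog : PowerSeries.derivative K (PowerSeries.log K) * (1 + PowerSeries.X) = 1 := by
    rw [PowerSeries.deriv_log]
    ext n
    cases n with
    | zero => simp
    | succ n =>
      rw [mul_add, mul_one, map_add, PowerSeries.coeff_succ_mul_X]
      simp [PowerSeries.coeff_one, pow_succ]
  have h := congrArg (PowerSeries.subst (f - 1)) hlog
  rw [PowerSeries.subst_mul hs, PowerSeries.subst_add hs, PowerSeries.subst_X hs] at h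
  have h1 : PowerSeries.subst (f - 1) (1 : K⟦X⟧) = (1 : K⟦X⟧) := by
    rw [← PowerSeries.coe_substAlgHom hs, map_one]
  rw [h1, add_sub_cancel] at h
  rw [PowerSeries.logOf_eq, PowerSeries.derivative_subst hs, mul_right_comm, h, one_mul, map_sub,
    PowerSeries.derivative_one, sub_zero]

/-- The logarithm takes products of power series with constant term `1` to sums. -/
theorem logOf_mul {f g : K⟦X⟧} (hf : PowerSeries.constantCoeff f = 1)
    (hg : PowerSeries.constantCoeff g = 1) :
    PowerSeries.logOf (f * g) = PowerSeries.logOf f + PowerSeries.logOf g := by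
  have hfg : PowerSeries.constantCoeff (f * g) = 1 := by rw [map_mul, hf, hg, one_mul]
  have hne : f * g ≠ 0 := by
    intro h
    simp [h] at hfg
  apply PowerSeries.derivative.ext
  · apply mul_right_cancel₀ hne
    rw [derivative_logOf_mul hfg, map_add, Derivation.leibniz, smul_eq_mul, smul_eq_mul]
    linear_combination -g * derivative_logOf_mul hf - f * derivative_logOf_mul hg
  · rw [map_add, PowerSeries.constantCoeff_logOf hfg, PowerSeries.constantCoeff_logOf hf,
      PowerSeries.constantCoeff_logOf hg, add_zero]

theorem logOf_rescale {f : K⟦X⟧} (hf : PowerSeries.constantCoeff f = 1) (a : K) :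
    PowerSeries.logOf (PowerSeries.rescale a f) =
      PowerSeries.rescale a (PowerSeries.logOf f) := by
  have hr : PowerSeries.constantCoeff (PowerSeries.rescale a f) = 1 := by
    rw [constantCoeff_rescale, hf]
  have hne : PowerSeries.rescale a f ≠ 0 := by
    intro h
    simp [h] at hr
  apply PowerSeries.derivative.ext
  · apply mul_right_cancel₀ hne
    rw [derivative_logOf_mul hr, derivative_rescale, derivative_rescale, mul_assoc, ← map_mul,
      derivative_logOf_mul hf]
  · rw [PowerSeries.constantCoeff_logOf hr, constantCoeff_rescale,
      PowerSeries.constantCoeff_logOf hf]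

theorem logOf_inv {f : K⟦X⟧} (hf : PowerSeries.constantCoeff f = 1) :
    PowerSeries.logOf f⁻¹ = -PowerSeries.logOf f := by
  have hi : PowerSeries.constantCoeff f⁻¹ = 1 := by
    rw [PowerSeries.constantCoeff_inv, hf, inv_one]
  have hone : PowerSeries.logOf (1 : K⟦X⟧) = 0 := by
    have h := logOf_mul (K := K) (f := 1) (g := 1) (map_one _) (map_one _)
    rw [mul_one] at h
    exact left_eq_add.mp h
  have h := logOf_mul hf hi
  rw [PowerSeries.mul_inv_cancel f (by rw [hf]; exact one_ne_zero), hone] at h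
  exact (neg_eq_of_add_eq_zero_right h.symm).symm

theorem neg_rescale_cumulantSeries (c : ℕ → K) :
    -PowerSeries.rescale (-1 : K) (cumulantSeries c) =
      cumulantSeries fun k => (-1 : K) ^ (k - 1) * c k := by
  ext k
  rw [map_neg, PowerSeries.coeff_rescale, cumulantSeries, cumulantSeries, PowerSeries.coeff_mk,
    PowerSeries.coeff_mk]
  -- At `k = 0` the truncated exponent `k - 1` is harmless because both coefficients vanish.
  cases k with
  | zero => simp
  | succ k =>
    rw [if_neg k.succ_ne_zero, if_neg k.succ_ne_zero, Nat.add_sub_cancel]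
    ring

end Log

end WronskianAppell

/-! ### The duality theorem -/

theorem theorem5p4 {K : Type*} [Field K] [CharZero K]
    (A : ℕ → Polynomial K) (hA : WronskianAppell.IsAppell A) :
    WronskianAppell.IsAppell (WronskianAppell.dual A) ∧
    (∀ μ : YoungDiagram,
      WronskianAppell.wronskianAppell (WronskianAppell.dual A) μ =
        WronskianAppell.wronskianAppell A μ.transpose) ∧
    WronskianAppell.genFun (WronskianAppell.dual A) =
      (PowerSeries.rescale (-1 : K) (WronskianAppell.genFun A))⁻¹ ∧
    (∀ c : ℕ → K,
      PowerSeries.logOf (WronskianAppell.genFun A) = WronskianAppell.cumulantSeries c →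
      PowerSeries.logOf (WronskianAppell.genFun (WronskianAppell.dual A)) =
        WronskianAppell.cumulantSeries fun k => (-1 : K) ^ (k - 1) * c k) := by
  have hf : PowerSeries.constantCoeff
      (PowerSeries.rescale (-1 : K) (WronskianAppell.genFun A)) = 1 := by
    rw [WronskianAppell.constantCoeff_rescale, WronskianAppell.constantCoeff_genFun hA]
  set g := (PowerSeries.rescale (-1 : K) (WronskianAppell.genFun A))⁻¹ with hg
  have hg1 : PowerSeries.constantCoeff g = 1 := by
    rw [hg, PowerSeries.constantCoeff_inv, hf, inv_one]
  have hB := WronskianAppell.isAppell_ofGenFun hg1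
  have hgen : WronskianAppell.genFun (WronskianAppell.ofGenFun g) = g :=
    WronskianAppell.genFun_ofGenFun g
  have hmul : PowerSeries.rescale (-1 : K) (WronskianAppell.genFun A) * g = 1 :=
    PowerSeries.mul_inv_cancel _ (by rw [hf]; exact one_ne_zero)
  -- Replace `t` by `-t` in `hmul`.
  have hAB : WronskianAppell.genFun A *
      PowerSeries.rescale (-1 : K) (WronskianAppell.genFun (WronskianAppell.ofGenFun g)) = 1 := by
    have h := congrArg (PowerSeries.rescale (-1 : K)) hmul
    rw [map_mul, map_one, PowerSeries.rescale_rescale, neg_one_mul, neg_neg,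
      PowerSeries.rescale_one, RingHom.id_apply] at h
    rw [hgen, h]
  have hswap := WronskianAppell.wronskianAppell_eq_wronskianAppell_transpose hA hB hAB
  -- The case `μ = (1ⁿ)` of `hswap` identifies the dual sequence.
  have hdual : WronskianAppell.dual A = WronskianAppell.ofGenFun g := by
    funext n
    rw [WronskianAppell.dual, hswap, WronskianAppell.wronskianAppell_transpose_column hB]
  rw [hdual]
  refine ⟨hB, fun μ => ?_, hgen, fun c hc => ?_⟩
  · rw [hswap, YoungDiagram.transpose_transpose]
  · rw [hgen, hg, WronskianAppell.logOf_inv hf,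
      WronskianAppell.logOf_rescale (WronskianAppell.constantCoeff_genFun hA), hc,
      WronskianAppell.neg_rescale_cumulantSeries]
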